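/- **Theorem.** Let $T$ be a complete first-order theory in a language $L$ (write $|T|=|L|+\aleph_0$), and let $\lambda,\kappa$ be infinite regular cardinals with $\lambda=\lambda^{<\lambda}>|T|$, $\lambda>\aleph_0$, $\kappa<\lambda$ and $2^\lambda=\lambda^+$. Assume that $T$ has the strong independence property, i.e. some formula $\varphi(\bar x,\bar y)$ (with $\bar x,\bar y$ finite tuples of variables, $\bar y$ nonempty) has it for $T$: for every model $N$ of $T$ and all disjoint finite sets $I_1,I_2$ of $\bar y$-tuples from $N$ there is an $\bar x$-tuple $\bar a$ from $N$ such that $N\models\neg\varphi[\bar a,\bar b]$ for $\bar b\in I_1$ and $N\models\varphi[\bar a,\bar b]$ for $\bar b\in I_2$. Let $M$ be a saturated model of $T$ of cardinality $\lambda^+$, and let $\langle M_\alpha:\alpha<\lambda^+\rangle$ be a $\prec$-increasing continuous sequence of models of cardinality $\lambda$ with union $M$. For a model $N$ of cardinality $\lambda$, a formula $\varphi(\bar x,\bar y)$, a bijection $f:N\to\lambda$ and $\delta<\lambda$, let $\mathrm{inv}^{\varphi}_{7,\kappa}(\delta,f,N)$ be the set of those $\mathcal P\subseteq\mathcal P(\delta)$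 for which there are $\bar x$-tuples $\bar a^i_\gamma$ from $f^{-1}[\delta]$ ($\gamma<\delta$, $i<\kappa$) such that for every $U\subseteq\delta$: $U\in\mathcal P$ if and only if there is a $\bar y$-tuple $\bar b$ from $N$ such that for all sufficiently large $i<\kappa$ and all $\gamma<\delta$, $N\models\varphi[\bar a^i_\gamma,\bar b]\Leftrightarrow\gamma\in U$. Let $\mathrm{inv}^{\varphi}_{8,\kappa}(N)$ be the class of $\langle \mathrm{inv}^{\varphi}_{7,\kappa}(\delta,f,N):\delta<\lambda\rangle$ modulo the club filter on $\lambda$ (this does not depend on $f$). Then there is a club $E$ of $\lambda^+$ such that for any two distinct $\delta_1,\delta_2\in E$ of cofinality $\kappa$, $M_{\delta_1}\not\cong M_{\delta_2}$; moreover, $\mathrm{inv}^{\varphi}_{8,\kappa}(M_{\delta_1})\neq\mathrm{inv}^{\varphi}_{8,\kappa}(M_{\delta_2})$ for every $\varphi$ that has the strong independence property for $T$ (computed from any bijections of $M_{\delta_1}$, $M_{\delta_2}$ with $\lambda$). Consequently $T$ has no $(\lambda,\kappa)$-limit model: there are no saturated model $M'$ of $T$ of cardinality $\lambda^+$ and $\prec$-increasing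 continuous sequence $\langle M'_\alpha:\alpha<\lambda^+\rangle$ of models of cardinality $\lambda$ with union $M'$ for which $\min_{E'}\bigl|\{M'_\delta/{\cong}:\delta\in E',\ \mathrm{cf}(\delta)=\kappa\}\bigr|=1$, where $E'$ ranges over the clubs of $\lambda^+$. -/

import Mathlib

universe u v w

open FirstOrder Cardinal

noncomputable section

namespace NoLimitModel

variable {L : FirstOrder.Language.{u, v}}

/-- The formula `φ(x̄, ȳ)` has the strong independence property for `T`: in every model of `T`, any
two disjoint finite sets of `ȳ`-tuples are separated by an instance `φ(ā, ȳ)`. The tuple `ȳ` is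
required to be nonempty (for the empty tuple the condition would only say that `φ(x̄)` is neither
valid nor contradictory). -/
def FormulaHasSIP (T : L.Theory) {n m : ℕ} (φ : L.Formula (Fin n ⊕ Fin m)) : Prop :=
  0 < m ∧ ∀ (M : T.ModelType.{u, v, w}) (I₁ I₂ : Finset (Fin m → M)), Disjoint I₁ I₂ →
    ∃ a : Fin n → M, (∀ b ∈ I₁, ¬ φ.Realize (Sum.elim a b)) ∧
      (∀ b ∈ I₂, φ.Realize (Sum.elim a b))

/-- `T` has the strong independence property: some formula has it for `T`. -/
def HasSIP (T : L.Theory) : Prop :=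
  ∃ (n m : ℕ) (φ : L.Formula (Fin n ⊕ Fin m)), FormulaHasSIP.{u, v, w} T φ

/-- `M` is saturated: every complete `1`-type over fewer than `#M` parameters of `M` is realized
in `M`. -/
def IsSaturated (L : FirstOrder.Language.{u, v}) (M : Type w) [L.Structure M] [Nonempty M] :
    Prop :=
  ∀ A : Set M, #A < #M → ∀ p : (L[[A]].completeTheory M).CompleteType (Fin 1),
    p ∈ (L[[A]].completeTheory M).realizedTypes M (Fin 1)

/-- The initial ordinal of `c`, as a well-ordered type; its elements are the ordinals below `c`. -/
abbrev Idx (c : Cardinal.{w}) : Type w := c.ord.ToType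

/-- The cofinality of the ordinal `δ < c`. -/
abbrev cofAt {c : Cardinal.{w}} (δ : Idx c) : Cardinal.{w} := Order.cof (Set.Iio δ)

/-- `⟨C α : α < lam⁺⟩` is an increasing continuous chain of elementary submodels of `M`, all of
cardinality `lam`, with union `M`. (By Tarski's theorem on elementary chains every member of a
continuous elementary chain with union `M` is an elementary submodel of `M`.) -/
structure IsFiltration {M : Type w} [L.Structure M] (lam : Cardinal.{w})
    (C : Idx (Order.succ lam) → L.ElementarySubstructure M) : Prop where
  monotone : Monotone C
  continuous : ∀ δ, Order.IsSuccLimit δ → (C δ : Set M) = ⋃ α ∈ Set.Iio δ, (C α : Set M)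
  union_eq : ⋃ α, (C α : Set M) = Set.univ
  card_eq : ∀ α, #(C α) = lam

/-- The filter generated by the club subsets of the ordinal `lam`; for regular uncountable `lam`
this is the club filter. -/
def clubFilter (lam : Cardinal.{w}) : Filter (Idx lam) :=
  Filter.generate {s | IsClub s}

/-- The invariant `inv^φ_{7,κ}(δ, N')`, where `N'` is the copy of `N` with universe `lam` obtained
by transport along the bijection `f`. It is the set of all families `P` of subsets of `δ` for which
there are `x̄`-tuples `a i γ` (`i < κ`, `γ < δ`) of elements below `δ` such that `P` consists of the
`U ⊆ δ` for which some `b̄` in `N` satisfies, for all large enough `i < κ`: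
for every `γ < δ`, `φ(a i γ, b̄)` holds iff `γ ∈ U`. -/
def inv7 {N : Type w} [L.Structure N] {n m : ℕ} (φ : L.Formula (Fin n ⊕ Fin m))
    (κ : Cardinal.{w}) {lam : Cardinal.{w}} (f : N ≃ Idx lam) (δ : Idx lam) :
    Set (Set (Set (Idx lam))) :=
  {P | (∀ U ∈ P, U ⊆ Set.Iio δ) ∧
    ∃ a : Idx κ → Set.Iio δ → Fin n → N, (∀ i γ k, f (a i γ k) < δ) ∧
      ∀ U ⊆ Set.Iio δ, U ∈ P ↔
        ∃ b : Fin m → N, ∃ i₀ : Idx κ, ∀ i ≥ i₀, ∀ γ : Set.Iio δ,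
          φ.Realize (Sum.elim (a i γ) b) ↔ (γ : Idx lam) ∈ U}

/-- The invariant `inv^φ_{8,κ}(N)` of a model `N` of cardinality `lam`, computed from a bijection
`f` of `N` with `lam`: the class of `⟨inv^φ_{7,κ}(δ, N') : δ < lam⟩` modulo the club filter. -/
def inv8 {N : Type w} [L.Structure N] {n m : ℕ} (φ : L.Formula (Fin n ⊕ Fin m))
    (κ : Cardinal.{w}) {lam : Cardinal.{w}} (f : N ≃ Idx lam) :
    Filter.Germ (clubFilter lam) (Set (Set (Set (Idx lam)))) :=
  ((fun δ => inv7 φ κ f δ : Idx lam → Set (Set (Set (Idx lam)))) :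
    Filter.Germ (clubFilter lam) (Set (Set (Set (Idx lam)))))

/-- The isomorphism type of a structure. -/
def isoType (L : FirstOrder.Language.{u, v}) (N : Type w) [S : L.Structure N] :
    Quotient (FirstOrder.Language.equivSetoid (L := L)) :=
  Quotient.mk _ (⟨N, S⟩ : CategoryTheory.Bundled.{w} L.Structure)

/-- The least number of isomorphism types of the `C δ` with `δ` of cofinality `κ` in a club `E` of
`lam⁺`, over all clubs `E`. -/
def limitNumber {M : Type w} [L.Structure M] {lam : Cardinal.{w}}
    (C : Idx (Order.succ lam) → L.ElementarySubstructure M) (κ : Cardinal.{w}) :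
    Cardinal.{max u v (w + 1)} :=
  sInf {c | ∃ E : Set (Idx (Order.succ lam)), IsClub E ∧
    c = #((fun δ => isoType L (C δ)) '' {δ | δ ∈ E ∧ cofAt δ = κ})}

/-- `T` has a `(lam, κ)`-limit model (in the case `2 ^ lam = lam⁺`): for a filtration of a
saturated model of `T` of cardinality `lam⁺`, there is up to isomorphism exactly one member with
index of cofinality `κ` in a suitable club. -/
def HasLimitModel (T : L.Theory) (lam κ : Cardinal.{w}) : Prop :=
  ∃ (M : T.ModelType.{u, v, w}) (C : Idx (Order.succ lam) → L.ElementarySubstructure M),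
    IsSaturated L M ∧ #M = Order.succ lam ∧ IsFiltration lam C ∧ limitNumber C κ = 1

end NoLimitModel

end

/-!
The invariants of the members of the chain are separated by diagonalization followed by coding.

*Diagonalization.* For `κ ≤ |ε|` the set `inv7 φ κ f ε` has at most `2 ^ |ε|` members, one for each
choice of the tuples `a i γ` below `ε`. There are `2 ^ |ε|` unbounded subsets of `ε`, so a Cantor
argument gives a family `P ε` of subsets of `ε` that contains all bounded ones and is not a member
of `inv7 φ κ f ε` (`exists_notMem_inv7`). For each `δ₁`, families `P ε` of this kind are fixed for
`C δ₁` and for all `ε < lam` of cofinality `ω` above some bound.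

*Coding.* For `δ₂` of cofinality `κ` in a suitable club above `δ₁`, all these families `P ε` are
members of `inv7 φ κ f ε` computed in `C δ₂`, for `ε` in a club (`exists_forall_mem_inv7`). Since
`lam ^< lam = lam`, there are at most `lam` pairs `(ε, U)` with `U ∈ P ε`, and each gets a name in
one model of the chain. By the strong independence property and saturation
(`IsSaturated.exists_realize`) there are, for each `α`, tuples `a` in `M` whose `φ`-type over `C α`
is prescribed: on (a tuple starting with) the name of `(ε, U)` it spells `U`, on all other tuples
it is constantly false. Along a `κ`-sequence of indices `α` with limit `δ₂` these tuples lie in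
`C δ₂`, and every `b̄` in `C δ₂` lies in some `C α` of the sequence, hence obeys the prescription
from there on.

The difficulty is that the tuples used at `ε` have to lie below `ε`, so that different `ε` must
share them, whereas the families `P ε` are unrelated. The tuples are therefore indexed by pairs
`(γ, ζ)` of ordinals, and at `ε` only the pairs `(γ, ξ ε γ)` are read, where `ξ ε γ` is the first
term `≥ γ` of a cofinal `ω`-sequence in `ε`. For `ε ≠ ε'` the functions `ξ ε` and `ξ ε'` differ from
some point on below `min ε ε'` (`exists_jump`, `exists_bound_of_jump_ne`), so the name of `(ε, U)`
spells a bounded set at `ε' ≠ ε`, and bounded sets belong to `P ε'` anyway.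

The ordinals of cofinality `ω` are stationary in `lam`, so the invariants differ modulo the club
filter. The ordinals of cofinality `κ` are stationary in `lam⁺`, so every club contains two that
index nonisomorphic models, which excludes a limit model.
-/

namespace NoLimitModel

open FirstOrder.Language

variable {L : FirstOrder.Language.{u, v}}

/-! ### Realizing types in saturated models -/

/-- In a saturated model `M`, a partial elementary map from fewer than `#M` elements of `M` into a
structure `N` (presented by two families `x`, `y` of the same type) can be extended by a preimage
of any given element of `N`. -/
theorem IsSaturated.exists_extend {M : Type w} [L.Structure M] [Nonempty M]
    (hsat : IsSaturated L M) {J : Type*} (x : J → M) (hx : #(Set.range x) < #M)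
    {N : Type w} [L.Structure N] [Nonempty N] (y : J → N)
    (hxy : ∀ ψ : L.Formula J, ψ.Realize x ↔ ψ.Realize y) (s : N) :
    ∃ c : M, ∀ ψ : L.Formula (Option J),
      ψ.Realize (fun o => o.elim c x) ↔ ψ.Realize (fun o => o.elim s y) := by
  classical
  set A : Set M := Set.range x with hA
  choose r hr using fun a : A => a.2
  have hyr : ∀ i j, x i = x j → y i = y j := by
    intro i j hij
    have := hxy ((Term.var i).equal (Term.var j))
    simpa [hij] using this
  -- `N` names the parameters through `y`; this does not depend on the chosen preimages `r`.
  let _ : (constantsOn A).Structure N := constantsOn.structure (fun a => y (r a))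
  have _ : N ⊨ L[[A]].completeTheory M := by
    refine (Theory.model_iff _).2 fun σ hσ => ?_
    obtain ⟨ψ, rfl⟩ := (Formula.equivSentence (L := L) (α := A)).surjective σ
    have h1 : M ⊨ Formula.equivSentence ψ := hσ
    have h2 : ψ.Realize (fun a : A => (a : M)) := (Formula.realize_equivSentence M ψ).1 h1
    refine (Formula.realize_equivSentence N ψ).2 ?_
    have h3 := hxy (ψ.relabel r)
    rw [Formula.realize_relabel, Formula.realize_relabel] at h3
    refine h3.1 ?_
    convert h2 using 1
    funext a
    exact hr a
  obtain ⟨c, hc⟩ := hsat A hx ((L[[A]].completeTheory M).typeOf (fun _ : Fin 1 => s))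
  refine ⟨c 0, fun ψ => ?_⟩
  let χ : L[[A]].Formula (Fin 1) := BoundedFormula.constantsVarsEquiv.symm
    (ψ.relabel (fun o : Option J => o.elim (Sum.inr 0) (fun j => Sum.inl ⟨x j, j, rfl⟩)) :
      L.Formula (A ⊕ Fin 1))
  have key : χ.Realize c ↔ χ.Realize (fun _ : Fin 1 => s) := by
    rw [← Theory.CompleteType.formula_mem_typeOf (T := L[[A]].completeTheory M),
      ← Theory.CompleteType.formula_mem_typeOf (T := L[[A]].completeTheory M), hc]
  have real : ∀ {K : Type w} [L.Structure K] [L[[A]].Structure K]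
      [(L.lhomWithConstants A).IsExpansionOn K] (d : Fin 1 → K), χ.Realize d ↔
      ψ.Realize (fun o => o.elim (d 0)
        (fun j => ((L.con (⟨x j, j, rfl⟩ : A) : L[[A]].Constants) : K))) := by
    intro K _ _ _ d
    have := BoundedFormula.realize_constantsVarsEquiv (M := K) (φ := χ) (v := d) (xs := default)
    rw [Formula.Realize, ← this]
    simp only [χ, Equiv.apply_symm_apply]
    change Formula.Realize _ _ ↔ _
    rw [Formula.realize_relabel]
    refine iff_of_eq (congrArg _ ?_)
    funext o
    cases o <;> rfl
  rw [real, real] at key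
  have hN : (fun o : Option J => o.elim s
      (fun j => ((L.con (⟨x j, j, rfl⟩ : A) : L[[A]].Constants) : N))) = fun o => o.elim s y := by
    funext o
    cases o with
    | none => rfl
    | some j => exact hyr _ _ (hr ⟨x j, j, rfl⟩)
  rw [hN] at key
  exact key

theorem IsSaturated.exists_extend_fin {M : Type w} [L.Structure M] [Nonempty M] [Infinite M]
    (hsat : IsSaturated L M) {J : Type*} (x : J → M) (hx : #(Set.range x) < #M)
    {N : Type w} [L.Structure N] [Nonempty N] (y : J → N)
    (hxy : ∀ ψ : L.Formula J, ψ.Realize x ↔ ψ.Realize y) {k : ℕ} (t : Fin k → N) :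
    ∃ c : Fin k → M, ∀ ψ : L.Formula (J ⊕ Fin k),
      ψ.Realize (Sum.elim x c) ↔ ψ.Realize (Sum.elim y t) := by
  induction k with
  | zero =>
    refine ⟨Fin.elim0, fun ψ => ?_⟩
    have := hxy (ψ.relabel (Sum.elim id Fin.elim0))
    rw [Formula.realize_relabel, Formula.realize_relabel] at this
    convert this using 2 <;>
    · funext o
      rcases o with o | o
      · rfl
      · exact o.elim0
  | succ k ih =>
    obtain ⟨c, hc⟩ := ih (fun i => t i.castSucc)
    have hcard : #(Set.range (Sum.elim x c)) < #M := by
      rw [Set.Sum.elim_range]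
      refine (mk_union_le _ _).trans_lt (add_lt_of_lt (aleph0_le_mk M) hx ?_)
      exact (Set.finite_range c).lt_aleph0.trans_le (aleph0_le_mk M)
    obtain ⟨d, hd⟩ := hsat.exists_extend _ hcard _ hc (t (Fin.last k))
    refine ⟨Fin.snoc c d, fun ψ => ?_⟩
    have := hd (ψ.relabel (Sum.elim (fun j => some (Sum.inl j))
      (Fin.lastCases none (fun i => some (Sum.inr i)))))
    rw [Formula.realize_relabel, Formula.realize_relabel] at this
    convert this using 2
    · funext o
      rcases o with o | o
      · rfl
      · induction o using Fin.lastCases <;> simp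
    · funext o
      rcases o with o | o
      · rfl
      · induction o using Fin.lastCases <;> simp

/-- A saturated model realizes every finitely satisfiable set of instances of `φ(x̄, b̄)` and their
negations, with the parameters `b̄` taken from a set `B` of fewer than `#M` elements. The set is
realized in the ultrapower of `M` along an ultrafilter on `M^n`, and the realization is pulled back
to `M` over `B`. -/
theorem IsSaturated.exists_realize {M : Type w} [L.Structure M] [Nonempty M] [Infinite M]
    (hsat : IsSaturated L M) {B : Set M} (hB : #B < #M) {n m : ℕ}
    (φ : L.Formula (Fin n ⊕ Fin m)) (R : Set (Fin m → M))
    (hfin : ∀ I₁ I₂ : Finset (Fin m → M), Disjoint I₁ I₂ →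
      ∃ a : Fin n → M, (∀ b ∈ I₁, ¬ φ.Realize (Sum.elim a b)) ∧
        (∀ b ∈ I₂, φ.Realize (Sum.elim a b))) :
    ∃ a : Fin n → M, ∀ b : Fin m → M, (∀ k, b k ∈ B) → (φ.Realize (Sum.elim a b) ↔ b ∈ R) := by
  classical
  let D : (Fin m → M) → Set (Fin n → M) := fun b => {a | φ.Realize (Sum.elim a b) ↔ b ∈ R}
  have hne : (Filter.generate (Set.range D)).NeBot := by
    rw [Filter.generate_neBot_iff]
    intro t ht htf
    have := htf.to_subtype
    choose g hg using fun d : t => ht d.2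
    let I : Finset (Fin m → M) := (Set.finite_range g).toFinset
    obtain ⟨a, ha₁, ha₂⟩ := hfin (I.filter (· ∉ R)) (I.filter (· ∈ R))
      (Finset.disjoint_filter_filter_not _ _ _).symm
    refine ⟨a, fun d hd => ?_⟩
    have hI : g ⟨d, hd⟩ ∈ I := by simp [I]
    change a ∈ ((⟨d, hd⟩ : t) : Set (Fin n → M))
    rw [← hg ⟨d, hd⟩]
    by_cases hR : g ⟨d, hd⟩ ∈ R
    · exact iff_of_true (ha₂ _ (Finset.mem_filter.2 ⟨hI, hR⟩)) hR
    · exact iff_of_false (ha₁ _ (Finset.mem_filter.2 ⟨hI, hR⟩)) hR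
  obtain ⟨U, hU⟩ := Ultrafilter.exists_le (Filter.generate (Set.range D))
  have hD : ∀ b, D b ∈ U := fun b => hU (Filter.mem_generate_of_mem ⟨b, rfl⟩)
  let N := (U : Filter (Fin n → M)).Product fun _ => M
  let y : B → N := fun b => ((fun _ => (b : M) : (Fin n → M) → M) : N)
  let t : Fin n → N := fun k => ((fun a => a k : (Fin n → M) → M) : N)
  have hy : ∀ ψ : L.Formula B, ψ.Realize (fun b : B => (b : M)) ↔ ψ.Realize y := by
    intro ψ
    refine Iff.trans ?_ (Ultraproduct.realize_formula_cast (M := fun _ : Fin n → M => M) (u := U) ψ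
      (fun b _ => (b : M))).symm
    simp
  obtain ⟨a, ha⟩ := hsat.exists_extend_fin (fun b : B => (b : M)) (by simpa using hB) y hy t
  refine ⟨a, fun b hb => ?_⟩
  have h1 := ha (φ.relabel (Sum.elim Sum.inr (fun k => Sum.inl ⟨b k, hb k⟩)))
  rw [Formula.realize_relabel, Formula.realize_relabel] at h1
  have h2 := Ultraproduct.realize_formula_cast (M := fun _ : Fin n → M => M) (u := U) φ
    (Sum.elim (fun k a => a k) (fun k _ => b k))
  have h3 : (Sum.elim y t ∘ Sum.elim Sum.inr (fun k => Sum.inl ⟨b k, hb k⟩) : Fin n ⊕ Fin m → N) =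
      fun i => ((Sum.elim (fun k a => a k) (fun k _ => b k) i : (Fin n → M) → M) : N) := by
    funext i
    cases i <;> rfl
  have h4 : (Sum.elim (fun b : B => (b : M)) a ∘ Sum.elim Sum.inr (fun k => Sum.inl ⟨b k, hb k⟩) :
      Fin n ⊕ Fin m → M) = Sum.elim a b := by
    funext i
    cases i <;> rfl
  rw [h3, h4] at h1
  refine (h1.trans h2).trans ?_
  have h5 : ∀ᶠ a in (U : Filter (Fin n → M)), (φ.Realize (fun i =>
      (Sum.elim (fun k a => a k) (fun k _ => b k) i : (Fin n → M) → M) a) ↔ b ∈ R) := by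
    filter_upwards [hD b] with a ha
    have h6 : (fun i => (Sum.elim (fun k a => a k) (fun k _ => b k) i : (Fin n → M) → M) a) =
        Sum.elim a b := by
      funext i
      cases i <;> rfl
    rw [h6]
    exact ha
  rw [Filter.eventually_congr h5, Filter.eventually_const]

/-! ### Clubs and cofinalities -/

theorem cof_idx {c : Cardinal.{w}} (hc : c.IsRegular) : Order.cof (Idx c) = c := by
  simp [hc.cof_ord]

theorem noMaxOrder_idx {c : Cardinal.{w}} (hc : ℵ₀ ≤ c) : NoMaxOrder (Idx c) :=
  Cardinal.noMaxOrder hc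

theorem mk_Iio_idx_lt {c : Cardinal.{w}} (x : Idx c) : #(Set.Iio x) < c := by
  simpa using Cardinal.mk_Iio_lt x (by simp)

theorem mk_Iic_idx_lt {c : Cardinal.{w}} (hc : ℵ₀ ≤ c) (x : Idx c) : #(Set.Iic x) < c := by
  have := noMaxOrder_idx hc
  obtain ⟨y, hy⟩ := exists_gt x
  exact (Cardinal.mk_le_mk_of_subset (Set.Iic_subset_Iio.2 hy)).trans_lt (mk_Iio_idx_lt y)

/-- A family of fewer than `c` ordinals below a regular cardinal `c` is bounded. -/
theorem exists_forall_lt {c : Cardinal.{w}} (hc : c.IsRegular) {ι : Type v} (f : ι → Idx c)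
    (hι : Cardinal.lift.{w} #ι < Cardinal.lift.{v} c) : ∃ b, ∀ i, f i < b := by
  have h : ¬ IsCofinal (Set.range f) := by
    intro h
    have h1 := Order.cof_le h
    rw [cof_idx hc] at h1
    have h2 := (Cardinal.lift_le.{v}.2 h1).trans (Cardinal.mk_range_le_lift (f := f))
    exact absurd h2 (not_le.2 hι)
  obtain ⟨b, hb⟩ := not_isCofinal_iff.1 h
  exact ⟨b, fun i => hb _ ⟨i, rfl⟩⟩

theorem exists_isLUB {c : Cardinal.{w}} {t : Set (Idx c)} (ht : BddAbove t) : ∃ x, IsLUB t x :=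
  ⟨_, WellFounded.min_mem wellFounded_lt (upperBounds t) ht,
    fun _ hy => WellFounded.min_le wellFounded_lt hy⟩

/-- The closure points of fewer than `c` binary functions on a regular uncountable cardinal `c` form
a club. -/
theorem isClub_closurePoints {c : Cardinal.{w}} (hc : c.IsRegular) (hunc : ℵ₀ < c) {J : Type v}
    (hJ : Cardinal.lift.{w} #J < Cardinal.lift.{v} c) (h : Idx c → Idx c → J → Idx c) :
    IsClub {ε : Idx c | ∀ γ < ε, ∀ ξ < ε, ∀ j, h γ ξ j < ε} where
  dirSupClosed := by
    rw [dirSupClosed_iff_of_linearOrder]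
    intro t ht hne ε hε γ hγ ξ hξ j
    obtain ⟨x, hx, hγx⟩ := (lt_isLUB_iff hε).1 hγ
    obtain ⟨y, hy, hξy⟩ := (lt_isLUB_iff hε).1 hξ
    have hz : max x y ∈ t := by rcases max_choice x y with h | h <;> rw [h] <;> assumption
    exact (ht hz γ (hγx.trans_le (le_max_left _ _)) ξ (hξy.trans_le (le_max_right _ _)) j).trans_le
      (hε.1 hz)
  isCofinal := by
    intro a
    have hb : ∀ x : Idx c, ∃ b, x < b ∧ ∀ γ ≤ x, ∀ ξ ≤ x, ∀ j, h γ ξ j < b := by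
      intro x
      obtain ⟨b, hb⟩ := exists_forall_lt hc
        (fun p : Set.Iic x × Set.Iic x × J => h p.1 p.2.1 p.2.2) (by
          have hx : Cardinal.lift.{max v w} #(Set.Iic x) < Cardinal.lift.{max v w} c :=
            Cardinal.lift_lt.2 (mk_Iic_idx_lt hunc.le x)
          have hi : ℵ₀ ≤ Cardinal.lift.{max v w} c := by simpa using hunc.le
          have hJ : Cardinal.lift.{w} #J < Cardinal.lift.{max v w} c := by
            rwa [Cardinal.lift_umax.{w, v}]
          simpa using mul_lt_of_lt hi hx (mul_lt_of_lt hi hx hJ))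
      have := noMaxOrder_idx hunc.le
      obtain ⟨y, hy⟩ := exists_gt (max b x)
      refine ⟨y, (le_max_right _ _).trans_lt hy, fun γ hγ ξ hξ j => ?_⟩
      exact (hb (⟨γ, hγ⟩, ⟨ξ, hξ⟩, j)).trans ((le_max_left _ _).trans_lt hy)
    choose g hg hgh using hb
    let s : ℕ → Idx c := fun k => g^[k] a
    have hs : ∀ k, s (k + 1) = g (s k) := fun k => Function.iterate_succ_apply' g k a
    have hmono : StrictMono s := strictMono_nat_of_lt_succ fun k => by rw [hs]; exact hg _
    obtain ⟨b, hb⟩ := exists_forall_lt hc s (by simpa using hunc)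
    obtain ⟨ε, hε⟩ := exists_isLUB (t := Set.range s)
      ⟨b, by rintro _ ⟨k, rfl⟩; exact (hb k).le⟩
    refine ⟨ε, fun γ hγ ξ hξ j => ?_, hε.1 ⟨0, rfl⟩⟩
    obtain ⟨_, ⟨k, rfl⟩, hk⟩ := (lt_isLUB_iff hε).1 hγ
    obtain ⟨_, ⟨l, rfl⟩, hl⟩ := (lt_isLUB_iff hε).1 hξ
    have h1 := hgh (s (max k l)) γ (hk.le.trans (hmono.monotone (le_max_left _ _))) ξ
      (hl.le.trans (hmono.monotone (le_max_right _ _))) j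
    rw [← hs] at h1
    exact h1.trans_le (hε.1 ⟨_, rfl⟩)

/-- The ordinals of cofinality `κ` are stationary in `c`. -/
theorem exists_mem_isClub_cofAt_eq {c κ : Cardinal.{w}} (hc : c.IsRegular) (hκ : κ.IsRegular)
    (hκc : κ < c) {s : Set (Idx c)} (hs : IsClub s) (a : Idx c) :
    ∃ δ ∈ s, a < δ ∧ cofAt δ = κ := by
  have := noMaxOrder_idx hc.aleph0_le
  have := noMaxOrder_idx hκ.aleph0_le
  have step : ∀ (i : Idx κ) (f : ∀ j, j < i → Idx c), ∃ b ∈ s, a < b ∧ ∀ j hj, f j hj < b := by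
    intro i f
    obtain ⟨b, hb⟩ := exists_forall_lt hc (fun j : Set.Iio i => f j j.2) (by
      simpa using (mk_Iio_idx_lt i).trans hκc)
    obtain ⟨d, hd⟩ := exists_gt (max a b)
    obtain ⟨e, he, hde⟩ := hs.isCofinal d
    refine ⟨e, he, (le_max_left _ _).trans_lt (hd.trans_le hde), fun j hj => ?_⟩
    exact (hb ⟨j, hj⟩).trans ((le_max_right _ _).trans_lt (hd.trans_le hde))
  choose F hFs hFa hF using step
  let g : Idx κ → Idx c := (wellFounded_lt (α := Idx κ)).fix F
  have hg : ∀ i, g i = F i (fun j _ => g j) := fun i => WellFounded.fix_eq _ _ _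
  have hmono : StrictMono g := by
    intro j i hji
    rw [hg i]
    exact hF i (fun j _ => g j) j hji
  obtain ⟨b, hb⟩ := exists_forall_lt hc g (by simpa using hκc)
  obtain ⟨δ, hδ⟩ := exists_isLUB (t := Set.range g) ⟨b, by rintro _ ⟨k, rfl⟩; exact (hb k).le⟩
  have hne : Nonempty (Idx κ) := by
    rw [← Cardinal.mk_ne_zero_iff]
    simpa using hκ.ne_zero
  have hlt : ∀ i, g i < δ := fun i => by
    obtain ⟨j, hj⟩ := exists_gt i
    exact (hmono hj).trans_le (hδ.1 ⟨j, rfl⟩)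
  refine ⟨δ, hs.isLUB_mem ?_ (Set.range_nonempty g) hδ, ?_, ?_⟩
  · rintro _ ⟨i, rfl⟩
    rw [hg]
    exact hFs _ _
  · obtain ⟨i⟩ := hne
    refine lt_trans ?_ (hlt i)
    rw [hg]
    exact hFa _ _
  · have h1 := Order.cof_congr_of_strictMono (f := fun i => (⟨g i, hlt i⟩ : Set.Iio δ))
      (fun i j hij => hmono hij) (fun x => by
        obtain ⟨_, ⟨i, rfl⟩, hi⟩ := (lt_isLUB_iff hδ).1 x.2
        exact ⟨_, ⟨i, rfl⟩, hi.le⟩)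
    rw [cofAt, ← h1, cof_idx hκ]

/-- An ordinal of infinite cofinality is a limit. -/
theorem isSuccLimit_of_cofAt {c : Cardinal.{w}} {δ : Idx c} (h : ℵ₀ ≤ cofAt δ) :
    Order.IsSuccLimit δ := by
  have hne : Nonempty (Set.Iio δ) := Order.cof_ne_zero_iff.1 (aleph0_pos.trans_le h).ne'
  have htop : NoTopOrder (Set.Iio δ) := Order.one_lt_cof_iff.1 (one_lt_aleph0.trans_le h)
  obtain ⟨x, hx⟩ := hne
  refine ⟨fun hmin => (hmin (le_of_lt hx)).not_gt hx, fun y hy => ?_⟩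
  obtain ⟨z, hz⟩ := exists_not_le (⟨y, hy.1⟩ : Set.Iio δ)
  exact hy.2 (not_le.1 hz) z.2

/-- An ordinal of cofinality `κ` is the limit of a `κ`-sequence. -/
theorem exists_seq_of_cofAt {c κ : Cardinal.{w}} (hκ : κ.IsRegular) {δ : Idx c}
    (h : cofAt δ = κ) :
    ∃ α : Idx κ → Idx c, (∀ i, α i < δ) ∧ ∀ β < δ, ∃ i₀, ∀ i ≥ i₀, β ≤ α i := by
  obtain ⟨s, hs, hsκ⟩ := Order.exists_cof_eq (Set.Iio δ)
  have hcard : #(Idx κ) = #s := by rw [hsκ, mk_ord_toType]; exact h.symm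
  obtain ⟨e⟩ := Cardinal.eq.1 hcard
  have step : ∀ i : Idx κ, ∃ x : Set.Iio δ, ∀ j ≤ i, ((e j : s) : Set.Iio δ) < x := by
    intro i
    have : ¬ IsCofinal (Set.range fun j : Set.Iic i => ((e j : s) : Set.Iio δ)) := by
      intro hcof
      have h1 := (Order.cof_le hcof).trans Cardinal.mk_range_le
      exact absurd ((h1.trans_lt (mk_Iic_idx_lt hκ.aleph0_le i))) (by rw [← h]; exact lt_irrefl _)
    obtain ⟨x, hx⟩ := not_isCofinal_iff.1 this
    exact ⟨x, fun j hj => hx _ ⟨⟨j, hj⟩, rfl⟩⟩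
  choose α hα using step
  refine ⟨fun i => α i, fun i => (α i).2, fun β hβ => ?_⟩
  obtain ⟨y, hy, hβy⟩ := hs ⟨β, hβ⟩
  refine ⟨e.symm ⟨y, hy⟩, fun i hi => ?_⟩
  have := hα i _ hi
  rw [e.apply_symm_apply] at this
  exact (hβy.trans this.le : (⟨β, hβ⟩ : Set.Iio δ) ≤ α i)

/-! ### The invariants at a single ordinal -/

theorem exists_isClub_subset {lam : Cardinal.{w}} (hreg : lam.IsRegular) (hunc : ℵ₀ < lam)
    {s : Set (Idx lam)} (hs : s ∈ clubFilter lam) : ∃ K ⊆ s, IsClub K := by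
  obtain ⟨t, ht, hfin, hts⟩ := Filter.mem_generate_iff.1 hs
  exact ⟨_, hts, IsClub.sInter_of_countable (by rw [cof_idx hreg]; exact hunc.ne') hfin.countable
    fun x hx => ht hx⟩

theorem inv7_congr {N : Type w} [L.Structure N] {n m : ℕ} (φ : L.Formula (Fin n ⊕ Fin m))
    (κ : Cardinal.{w}) {lam : Cardinal.{w}} {f g : N ≃ Idx lam} {δ : Idx lam}
    (h : ∀ x, f x < δ ↔ g x < δ) : inv7 φ κ f δ = inv7 φ κ g δ := by
  simp only [inv7, h]

theorem inv7_subset_of_equiv {N N' : Type w} [L.Structure N] [L.Structure N'] (e : N ≃[L] N')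
    {n m : ℕ} (φ : L.Formula (Fin n ⊕ Fin m)) (κ : Cardinal.{w}) {lam : Cardinal.{w}}
    (f : N' ≃ Idx lam) (δ : Idx lam) : inv7 φ κ f δ ⊆ inv7 φ κ (e.toEquiv.trans f) δ := by
  have hcancel : ∀ {k : ℕ} (a : Fin k → N'), e ∘ (e.symm ∘ a) = a := fun a => by
    funext k
    exact e.apply_symm_apply (a k)
  have key : ∀ (a : Fin n → N) (b : Fin m → N),
      φ.Realize (Sum.elim (e ∘ a) (e ∘ b)) ↔ φ.Realize (Sum.elim a b) := by
    intro a b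
    rw [← Sum.comp_elim]
    exact Language.StrongHomClass.realize_formula e φ
  rintro P ⟨hsub, a, ha, hP⟩
  refine ⟨hsub, fun i γ => e.symm ∘ a i γ, fun i γ k => ?_, fun U hU => ?_⟩
  · change f (e (e.symm (a i γ k))) < δ
    rw [e.apply_symm_apply]
    exact ha i γ k
  rw [hP U hU]
  constructor
  · rintro ⟨b, i₀, h⟩
    refine ⟨e.symm ∘ b, i₀, fun i hi γ => ?_⟩
    rw [← h i hi γ, ← key, hcancel, hcancel]
  · rintro ⟨b, i₀, h⟩
    refine ⟨e ∘ b, i₀, fun i hi γ => ?_⟩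
    rw [← h i hi γ, ← key, hcancel]

theorem inv7_equiv {N N' : Type w} [L.Structure N] [L.Structure N'] (e : N ≃[L] N')
    {n m : ℕ} (φ : L.Formula (Fin n ⊕ Fin m)) (κ : Cardinal.{w}) {lam : Cardinal.{w}}
    (f : N' ≃ Idx lam) (δ : Idx lam) : inv7 φ κ f δ = inv7 φ κ (e.toEquiv.trans f) δ := by
  refine (inv7_subset_of_equiv e φ κ f δ).antisymm ?_
  have h : e.symm.toEquiv.trans (e.toEquiv.trans f) = f :=
    Equiv.ext fun x => congrArg f (e.apply_symm_apply x)
  simpa only [h] using inv7_subset_of_equiv e.symm φ κ (e.toEquiv.trans f) δ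

theorem exists_isClub_inv7_eq {N : Type w} [L.Structure N] (κ : Cardinal.{w}) {lam : Cardinal.{w}}
    (hreg : lam.IsRegular) (hunc : ℵ₀ < lam) (f g : N ≃ Idx lam) :
    ∃ K : Set (Idx lam), IsClub K ∧ ∀ ε ∈ K, ∀ (n m : ℕ) (φ : L.Formula (Fin n ⊕ Fin m)),
      inv7 φ κ f ε = inv7 φ κ g ε := by
  refine ⟨_, isClub_closurePoints hreg hunc (J := Bool)
    (by simpa using (Cardinal.natCast_lt_aleph0 (n := 2)).trans hunc)
    (fun γ _ b => cond b (f (g.symm γ)) (g (f.symm γ))), fun ε hε n m φ => ?_⟩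
  refine inv7_congr φ κ fun x => ⟨fun h => ?_, fun h => ?_⟩
  · simpa using hε _ h _ h false
  · simpa using hε _ h _ h true

/-- The unbounded subsets of an infinite ordinal `ε` are as many as all its subsets. -/
theorem two_power_le_mk_unbounded {lam : Cardinal.{w}} {ε : Idx lam}
    (hinf : ℵ₀ ≤ #(Set.Iio ε)) :
    (2 : Cardinal.{w}) ^ #(Set.Iio ε) ≤
      #{U : Set (Idx lam) // U ⊆ Set.Iio ε ∧ ∀ Δ < ε, ∃ γ ∈ U, Δ ≤ γ} := by
  classical
  set V := {U : Set (Idx lam) // U ⊆ Set.Iio ε ∧ ∀ Δ < ε, ∃ γ ∈ U, Δ ≤ γ}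
  -- Of a set and its complement in `ε` at least one is unbounded.
  have hcompl : ∀ S : Set (Set.Iio ε), (¬ ∀ Δ < ε, ∃ γ ∈ Subtype.val '' S, Δ ≤ γ) →
      ∀ Δ < ε, ∃ γ ∈ Subtype.val '' Sᶜ, Δ ≤ γ := by
    intro S hS Δ hΔ
    push Not at hS
    obtain ⟨Δ', hΔ', h⟩ := hS
    have hmax : max Δ Δ' < ε := max_lt hΔ hΔ'
    refine ⟨max Δ Δ', ⟨⟨_, hmax⟩, fun hmem => ?_, rfl⟩, le_max_left _ _⟩
    exact (h _ ⟨_, hmem, rfl⟩).not_ge (le_max_right _ _)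
  have hsub : ∀ S : Set (Set.Iio ε), Subtype.val '' S ⊆ Set.Iio ε := by
    rintro S _ ⟨x, -, rfl⟩
    exact x.2
  let F : Set (Set.Iio ε) → V × Bool := fun S =>
    if h : ∀ Δ < ε, ∃ γ ∈ Subtype.val '' S, Δ ≤ γ then (⟨_, hsub S, h⟩, true)
    else (⟨_, hsub Sᶜ, hcompl S h⟩, false)
  have hF : Function.Injective F := by
    intro S S' h
    simp only [F] at h
    split_ifs at h
    · exact Subtype.val_injective.image_injective (congrArg (fun p => p.1.1) h)
    · exact absurd (congrArg Prod.snd h) (by simp)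
    · exact absurd (congrArg Prod.snd h) (by simp)
    · exact compl_injective (Subtype.val_injective.image_injective (congrArg (fun p => p.1.1) h))
  have h1 := Cardinal.mk_le_of_injective hF
  rw [Cardinal.mk_set, Cardinal.mk_prod, Cardinal.lift_uzero, Cardinal.mk_bool, Cardinal.lift_ofNat]
    at h1
  have hV : ℵ₀ ≤ #V := by
    by_contra hV
    have h2 := Cardinal.mul_lt_aleph0 (not_le.1 hV) (Cardinal.natCast_lt_aleph0 (n := 2))
    exact absurd (h1.trans_lt h2) (not_lt.2 (hinf.trans (Cardinal.cantor _).le))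
  refine h1.trans (Cardinal.mul_le_of_le hV le_rfl ?_)
  exact (Cardinal.natCast_lt_aleph0 (n := 2)).le.trans hV

/-- `inv7 φ κ f ε` has at most `2 ^ |ε|` members, one for each choice of the sequence of tuples
below `ε`; so a diagonal argument over the `2 ^ |ε|` unbounded subsets of `ε` produces a family
outside `inv7 φ κ f ε` that still contains all bounded subsets of `ε`. -/
theorem exists_notMem_inv7 {N : Type w} [L.Structure N] {n m : ℕ} (φ : L.Formula (Fin n ⊕ Fin m))
    {κ lam : Cardinal.{w}} (hκ : ℵ₀ ≤ κ) (f : N ≃ Idx lam) {ε : Idx lam}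
    (hκε : κ ≤ #(Set.Iio ε)) :
    ∃ P : Set (Set (Idx lam)), (∀ U ∈ P, U ⊆ Set.Iio ε) ∧
      (∀ U ⊆ Set.Iio ε, (∃ Δ < ε, ∀ γ ∈ U, γ < Δ) → U ∈ P) ∧ P ∉ inv7 φ κ f ε := by
  classical
  set c := #(Set.Iio ε) with hc
  have hinf : ℵ₀ ≤ c := hκ.trans hκε
  let A := {a : Idx κ → Set.Iio ε → Fin n → N // ∀ i γ k, f (a i γ k) < ε}
  let V := {U : Set (Idx lam) // U ⊆ Set.Iio ε ∧ ∀ Δ < ε, ∃ γ ∈ U, Δ ≤ γ}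
  have hA : #A ≤ 2 ^ c := by
    have h1 : #A ≤ #(Idx κ → Set.Iio ε → Fin n → Set.Iio ε) :=
      Cardinal.mk_le_of_injective (f := fun a i γ k => ⟨f (a.1 i γ k), a.2 i γ k⟩) (by
        intro a b h
        ext i γ k
        have := congrFun (congrFun (congrFun h i) γ) k
        exact f.injective (congrArg Subtype.val this))
    refine h1.trans ?_
    have h2 : #(Idx κ → Set.Iio ε → Fin n → Set.Iio ε) = c ^ ((n : Cardinal.{w}) * c * κ) := by
      simp only [← Cardinal.power_def, Cardinal.power_mul, hc, Cardinal.mk_ord_toType,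
        Cardinal.mk_pi, Cardinal.prod_const, Cardinal.mk_fin,
        Cardinal.lift_uzero, Cardinal.lift_natCast, Cardinal.power_natCast]
    rw [h2, ← Cardinal.power_self_eq hinf]
    refine Cardinal.power_le_power_left (aleph0_pos.trans_le hinf).ne' ?_
    refine Cardinal.mul_le_of_le hinf (Cardinal.mul_le_of_le hinf ?_ le_rfl) hκε
    exact Cardinal.natCast_lt_aleph0.le.trans hinf
  obtain ⟨j⟩ : Nonempty (A ↪ V) :=
    Cardinal.le_def _ _ |>.1 (hA.trans (two_power_le_mk_unbounded hinf))
  let G : A → Set (Idx lam) → Prop := fun a U =>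
    ∃ b : Fin m → N, ∃ i₀ : Idx κ, ∀ i ≥ i₀, ∀ γ : Set.Iio ε,
      φ.Realize (Sum.elim (a.1 i γ) b) ↔ (γ : Idx lam) ∈ U
  refine ⟨{U | U ⊆ Set.Iio ε ∧ ((∃ Δ < ε, ∀ γ ∈ U, γ < Δ) ∨ ∃ a, U = (j a).1 ∧ ¬ G a U)},
    fun U hU => hU.1, fun U hU hb => ⟨hU, Or.inl hb⟩, ?_⟩
  -- If `a` coded this family, its own set `j a` would belong to it exactly if it does not.
  rintro ⟨-, a, ha, hP⟩
  have h := hP (j ⟨a, ha⟩).1 (j ⟨a, ha⟩).2.1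
  by_cases hG : G ⟨a, ha⟩ (j ⟨a, ha⟩).1
  · rcases (h.2 hG).2 with ⟨Δ, hΔ, hb⟩ | ⟨a', ha', hG'⟩
    · obtain ⟨γ, hγ, hΔγ⟩ := (j ⟨a, ha⟩).2.2 Δ hΔ
      exact (hb γ hγ).not_ge hΔγ
    · rw [← j.injective (Subtype.ext ha')] at hG'
      exact hG' hG
  · exact hG (h.1 ⟨(j ⟨a, ha⟩).2.1, Or.inr ⟨_, rfl, hG⟩⟩)

/-- An ordinal `ε` of cofinality `ω` carries a function `ξ : ε → ε` which, below every smaller limit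
ordinal `ε'`, eventually jumps over `ε'`: `ξ γ` is the first term `≥ γ` of a fixed cofinal
`ω`-sequence. -/
theorem exists_jump {lam : Cardinal.{w}} {ε : Idx lam} (hε : cofAt ε = ℵ₀) :
    ∃ ξ : Idx lam → Idx lam, (∀ γ < ε, ξ γ < ε) ∧
      ∀ ε' < ε, Order.IsSuccLimit ε' → ∃ Δ < ε', ∀ γ, Δ ≤ γ → γ < ε' → ε' ≤ ξ γ := by
  classical
  obtain ⟨s, hs, hsc⟩ := Order.exists_cof_eq (Set.Iio ε)
  obtain ⟨_⟩ := Cardinal.denumerable_iff.2 (hsc.trans hε)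
  let h : ℕ → Idx lam := fun k => ((Denumerable.eqv s).symm k : Set.Iio ε)
  have hlt : ∀ k, h k < ε := fun k => ((Denumerable.eqv s).symm k : Set.Iio ε).2
  have hcof : ∀ γ < ε, ∃ k, γ ≤ h k := by
    intro γ hγ
    obtain ⟨y, hy, hγy⟩ := hs ⟨γ, hγ⟩
    refine ⟨Denumerable.eqv s ⟨y, hy⟩, ?_⟩
    simp only [h, Equiv.symm_apply_apply]
    exact hγy
  refine ⟨fun γ => if hγ : ∃ k, γ ≤ h k then h (Nat.find hγ) else γ, fun γ hγ => ?_,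
    fun ε' hε' hlim => ?_⟩
  · simp only [dif_pos (hcof γ hγ)]
    exact hlt _
  · have hk₀ := hcof ε' hε'
    have hbd : ∀ k ≤ Nat.find hk₀, ∃ Δ < ε', ∀ j < k, h j < Δ := by
      intro k
      induction k with
      | zero =>
        intro _
        obtain ⟨x, hx⟩ := not_isMin_iff.1 hlim.not_isMin
        exact ⟨x, hx, fun j hj => absurd hj (Nat.not_lt_zero j)⟩
      | succ k ih =>
        intro hk
        obtain ⟨Δ, hΔ, hj⟩ := ih (Nat.le_of_succ_le hk)
        have hkε : h k < ε' := not_le.1 (Nat.find_min hk₀ hk)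
        obtain ⟨y, hy, hy'⟩ := (hlim.lt_iff_exists_lt).1 (max_lt hΔ hkε)
        refine ⟨y, hy, fun j hjk => ?_⟩
        rcases Nat.lt_succ_iff_lt_or_eq.1 hjk with hjk | rfl
        · exact (hj j hjk).trans ((le_max_left _ _).trans_lt hy')
        · exact (le_max_right _ _).trans_lt hy'
    obtain ⟨Δ, hΔ, hj⟩ := hbd _ le_rfl
    refine ⟨Δ, hΔ, fun γ hγ hγε => ?_⟩
    have hγk := hcof γ (hγε.trans hε')
    simp only [dif_pos hγk]
    have hle : Nat.find hγk ≤ Nat.find hk₀ :=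
      Nat.find_min' _ (hγε.le.trans (Nat.find_spec hk₀))
    rcases hle.lt_or_eq with hlt' | heq
    · exact absurd (hγ.trans (Nat.find_spec hγk)) (not_le.2 (hj _ hlt'))
    · rw [heq]
      exact Nat.find_spec hk₀

/-! ### Coding families of sets in the chain -/

/-- There are at most `lam` pairs of an ordinal `ε < lam` and a subset of `ε` if
`lam ^< lam = lam`. -/
theorem mk_sigma_families_le {lam : Cardinal.{w}} (hreg : lam.IsRegular)
    (hpow : lam ^< lam = lam) (S : Set (Idx lam)) (P : Idx lam → Set (Set (Idx lam)))
    (hP : ∀ ε ∈ S, ∀ U ∈ P ε, U ⊆ Set.Iio ε) :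
    #{p : Idx lam × Set (Idx lam) // p.1 ∈ S ∧ p.2 ∈ P p.1} ≤ lam := by
  have h1 : #{p : Idx lam × Set (Idx lam) // p.1 ∈ S ∧ p.2 ∈ P p.1} ≤
      #(Σ ε : Idx lam, Set (Set.Iio ε)) :=
    Cardinal.mk_le_of_injective (f := fun p => ⟨p.1.1, Subtype.val ⁻¹' p.1.2⟩) (by
      rintro ⟨⟨ε, U⟩, hε, hU⟩ ⟨⟨ε', U'⟩, hε', hU'⟩ h
      obtain rfl : ε = ε' := congrArg Sigma.fst h
      simp only [Sigma.mk.injEq, heq_eq_eq, true_and] at h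
      rw [Subtype.preimage_val_eq_preimage_val_iff, Set.inter_eq_right.2 (hP _ hε _ hU),
        Set.inter_eq_right.2 (hP _ hε' _ hU')] at h
      subst h
      rfl)
  refine h1.trans ?_
  rw [Cardinal.mk_sigma]
  refine (Cardinal.sum_le_sum _ (fun _ => lam) fun ε => ?_).trans ?_
  · rw [Cardinal.mk_set]
    calc (2 : Cardinal.{w}) ^ #(Set.Iio ε) ≤ lam ^ #(Set.Iio ε) :=
          Cardinal.power_le_power_right
            ((Cardinal.natCast_lt_aleph0 (n := 2)).le.trans hreg.aleph0_le)
      _ ≤ lam ^< lam := Cardinal.le_powerlt lam (mk_Iio_idx_lt ε)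
      _ = lam := hpow
  · rw [Cardinal.sum_const']
    simp [Cardinal.mul_eq_self hreg.aleph0_le]

/-- The jump functions of two different ordinals eventually differ below the smaller one, so a set
read off along the wrong jump function is bounded. -/
theorem exists_bound_of_jump_ne {lam : Cardinal.{w}} {S : Set (Idx lam)}
    (hS : ∀ ε ∈ S, Order.IsSuccLimit ε) {ξ : Idx lam → Idx lam → Idx lam}
    (hξ : ∀ ε ∈ S, ∀ γ < ε, ξ ε γ < ε)
    (hjump : ∀ ε ∈ S, ∀ ε' < ε, Order.IsSuccLimit ε' → ∃ Δ < ε', ∀ γ, Δ ≤ γ → γ < ε' →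
      ε' ≤ ξ ε γ) {ε ε' : Idx lam} (hε : ε ∈ S) (hε' : ε' ∈ S) (hne : ε ≠ ε') :
    ∃ Δ < ε', ∀ γ < ε, γ < ε' → ξ ε γ = ξ ε' γ → γ < Δ := by
  rcases lt_or_gt_of_ne hne with h | h
  · exact ⟨ε, h, fun γ hγ _ _ => hγ⟩
  · obtain ⟨Δ, hΔ, hj⟩ := hjump ε hε ε' h (hS ε' hε')
    refine ⟨Δ, hΔ, fun γ _ hγ' heq => ?_⟩
    by_contra hγ
    exact (hj γ (not_lt.1 hγ) hγ').not_gt (heq ▸ hξ ε' hε' γ hγ')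

/-- Coding of families. Let `P ε`, for `ε ∈ S`, be a family of subsets of `ε` that contains all
bounded ones. For some `g`, the families `P ε` are members of `inv7` (on a club) of every `C δ`
for which `δ` has cofinality `κ` and is closed under `g`. -/
theorem exists_forall_mem_inv7 {M : Type w} [L.Structure M] [Nonempty M]
    (hsat : IsSaturated L M) {lam κ : Cardinal.{w}} (hreg : lam.IsRegular) (hunc : ℵ₀ < lam)
    (hpow : lam ^< lam = lam) (hκ : κ.IsRegular) (hκlam : κ < lam)
    (hM : #M = Order.succ lam)
    {C : Idx (Order.succ lam) → L.ElementarySubstructure M} (hC : IsFiltration lam C)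
    {n m : ℕ} (hm : 0 < m) (φ : L.Formula (Fin n ⊕ Fin m))
    (hφ : ∀ I₁ I₂ : Finset (Fin m → M), Disjoint I₁ I₂ →
      ∃ a : Fin n → M, (∀ b ∈ I₁, ¬ φ.Realize (Sum.elim a b)) ∧
        (∀ b ∈ I₂, φ.Realize (Sum.elim a b)))
    (S : Set (Idx lam)) (hS : ∀ ε ∈ S, cofAt ε = ℵ₀) (P : Idx lam → Set (Set (Idx lam)))
    (hP : ∀ ε ∈ S, ∀ U ∈ P ε, U ⊆ Set.Iio ε)
    (hPb : ∀ ε ∈ S, ∀ U ⊆ Set.Iio ε, (∃ Δ < ε, ∀ γ ∈ U, γ < Δ) → U ∈ P ε) :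
    ∃ g : Idx (Order.succ lam) → Idx (Order.succ lam), ∀ δ, cofAt δ = κ → (∀ α < δ, g α < δ) →
      ∀ f : C δ ≃ Idx lam, ∃ K : Set (Idx lam), IsClub K ∧
        ∀ ε ∈ K, ε ∈ S → P ε ∈ inv7 φ κ f ε := by
  classical
  have hreg' : (Order.succ lam).IsRegular := Cardinal.isRegular_succ hreg.aleph0_le
  have hlim : ∀ ε ∈ S, Order.IsSuccLimit ε := fun ε hε => isSuccLimit_of_cofAt (hS ε hε).ge
  have : Infinite M := by
    rw [Cardinal.infinite_iff, hM]
    exact hreg'.aleph0_le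
  have hξ : ∀ ε, ∃ ξ : Idx lam → Idx lam, ε ∈ S → (∀ γ < ε, ξ γ < ε) ∧
      ∀ ε' < ε, Order.IsSuccLimit ε' → ∃ Δ < ε', ∀ γ, Δ ≤ γ → γ < ε' → ε' ≤ ξ γ := by
    intro ε
    by_cases hε : ε ∈ S
    · obtain ⟨ξ, h⟩ := exists_jump (hS ε hε)
      exact ⟨ξ, fun _ => h⟩
    · exact ⟨id, fun h => absurd h hε⟩
  choose ξ hξ using hξ
  -- Each pair `(ε, U)` with `U ∈ P ε` gets its own element of the model `C α₀`.
  obtain ⟨α₀⟩ : Nonempty (Idx (Order.succ lam)) := by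
    rw [← Cardinal.mk_ne_zero_iff]
    simp
  let Q := {p : Idx lam × Set (Idx lam) // p.1 ∈ S ∧ p.2 ∈ P p.1}
  obtain ⟨e⟩ : Nonempty (Q ↪ C α₀) := by
    rw [← Cardinal.le_def, hC.card_eq]
    exact mk_sigma_families_le hreg hpow S P hP
  let R : Idx lam → Idx lam → Set (Fin m → M) := fun γ ζ =>
    {b | ∃ p : Q, b ⟨0, hm⟩ = e p ∧ γ ∈ p.1.2 ∧ ξ p.1.1 γ = ζ}
  have hreal : ∀ α γ ζ, ∃ a : Fin n → M, ∀ b : Fin m → M, (∀ k, b k ∈ (C α : Set M)) →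
      (φ.Realize (Sum.elim a b) ↔ b ∈ R γ ζ) := by
    intro α γ ζ
    refine hsat.exists_realize ?_ φ (R γ ζ) hφ
    rw [hM]
    exact (hC.card_eq α).trans_lt (Order.lt_succ lam)
  choose a ha using hreal
  have hmem : ∀ x : M, ∃ β, x ∈ (C β : Set M) := fun x => by
    have : x ∈ ⋃ α, (C α : Set M) := hC.union_eq ▸ Set.mem_univ x
    simpa using this
  choose lev hlev using hmem
  have hg : ∀ α, ∃ β, α₀ < β ∧ ∀ γ ζ k, lev (a α γ ζ k) < β := by
    intro α
    obtain ⟨β, hβ⟩ := exists_forall_lt hreg'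
      (fun p : Idx lam × Idx lam × Fin n => lev (a α p.1 p.2.1 p.2.2)) (by
        have hn : (n : Cardinal.{w}) ≤ lam := Cardinal.natCast_lt_aleph0.le.trans hreg.aleph0_le
        have h1 : lam * (lam * (n : Cardinal.{w})) ≤ lam :=
          Cardinal.mul_le_of_le hreg.aleph0_le le_rfl
            (Cardinal.mul_le_of_le hreg.aleph0_le le_rfl hn)
        simpa using h1)
    have := noMaxOrder_idx hreg'.aleph0_le
    obtain ⟨β', hβ'⟩ := exists_gt (max β α₀)
    exact ⟨β', (le_max_right _ _).trans_lt hβ',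
      fun γ ζ k => (hβ (γ, ζ, k)).trans ((le_max_left _ _).trans_lt hβ')⟩
  choose g hg₀ hg using hg
  refine ⟨g, fun δ hδ hgδ f => ?_⟩
  have hδlim : Order.IsSuccLimit δ := isSuccLimit_of_cofAt (hδ ▸ hκ.aleph0_le)
  have hα₀ : α₀ < δ := by
    obtain ⟨x, hx⟩ := not_isMin_iff.1 hδlim.not_isMin
    exact (hg₀ x).trans (hgδ x hx)
  obtain ⟨s, hs, hscof⟩ := exists_seq_of_cofAt hκ hδ
  have hmem : ∀ i γ ζ k, a (s i) γ ζ k ∈ C δ := fun i γ ζ k =>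
    hC.monotone ((hg (s i) γ ζ k).trans (hgδ _ (hs i))).le (hlev _)
  let A : Idx κ → Idx lam → Idx lam → Fin n → C δ := fun i γ ζ k => ⟨a (s i) γ ζ k, hmem i γ ζ k⟩
  -- A parameter `b` lies in some `C (s i₀)`, and from `i₀` on it obeys the prescription `R`.
  have hA : ∀ b : Fin m → C δ, ∃ i₀, ∀ i ≥ i₀, ∀ γ ζ,
      φ.Realize (Sum.elim (A i γ ζ) b) ↔ (fun k => (b k : M)) ∈ R γ ζ := by
    intro b
    have hb : ∀ k, ∃ β < δ, (b k : M) ∈ (C β : Set M) := by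
      intro k
      have h : (b k : M) ∈ (C δ : Set M) := (b k).2
      rw [hC.continuous δ hδlim] at h
      simpa using h
    choose β hβ hbβ using hb
    choose i₀ hi₀ using fun k => hscof (β k) (hβ k)
    refine ⟨Finset.univ.sup' ⟨⟨0, hm⟩, Finset.mem_univ _⟩ i₀, fun i hi γ ζ => ?_⟩
    rw [← ha (s i) γ ζ _ fun k => hC.monotone
      (hi₀ k i ((Finset.le_sup' i₀ (Finset.mem_univ k)).trans hi)) (hbβ k)]
    rw [← (C δ).subtype.map_formula, Sum.comp_elim]
    rfl
  refine ⟨_, isClub_closurePoints hreg hunc (J := Idx κ × Fin n) (by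
    have hn : (n : Cardinal.{w}) < lam := Cardinal.natCast_lt_aleph0.trans hunc
    simpa using Cardinal.mul_lt_of_lt hreg.aleph0_le hκlam hn)
    (fun γ ζ j => f (A j.1 γ ζ j.2)), fun ε hε hεS => ?_⟩
  refine ⟨hP ε hεS, fun i γ => A i γ (ξ ε γ), fun i γ k =>
    hε γ γ.2 _ ((hξ ε hεS).1 γ γ.2) (i, k), fun U hU => ⟨fun hUP => ?_, ?_⟩⟩
  · let p : Q := ⟨(ε, U), hεS, hUP⟩
    let b : Fin m → C δ := fun _ => ⟨e p, hC.monotone hα₀.le (e p).2⟩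
    obtain ⟨i₀, hi₀⟩ := hA b
    refine ⟨b, i₀, fun i hi γ => ?_⟩
    rw [hi₀ i hi]
    constructor
    · rintro ⟨q, hq, hγ, -⟩
      rwa [← e.injective (Subtype.ext hq : e p = e q)] at hγ
    · exact fun hγ => ⟨p, rfl, hγ, rfl⟩
  · rintro ⟨b, i₀, hi₀⟩
    obtain ⟨i₁, hi₁⟩ := hA b
    have hbU : ∀ γ, γ < ε → (γ ∈ U ↔ (fun k => (b k : M)) ∈ R γ (ξ ε γ)) := fun γ hγ =>
      (hi₀ (max i₀ i₁) (le_max_left _ _) ⟨γ, hγ⟩).symm.trans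
        (hi₁ (max i₀ i₁) (le_max_right _ _) γ (ξ ε γ))
    -- If `b` starts with the name of some `(ε', U')`, then `U = U'` or `U` is bounded, according to
    -- whether `ε' = ε`; otherwise `U` is empty.
    by_cases hp : ∃ p : Q, (b ⟨0, hm⟩ : M) = e p
    · obtain ⟨p, hp⟩ := hp
      have hpU : ∀ γ, γ < ε → (γ ∈ U ↔ γ ∈ p.1.2 ∧ ξ p.1.1 γ = ξ ε γ) := by
        intro γ hγ
        rw [hbU γ hγ]
        constructor
        · rintro ⟨q, hq, h⟩
          rwa [← e.injective (Subtype.ext (hp.symm.trans hq) : e p = e q)] at h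
        · exact fun h => ⟨p, hp, h⟩
      by_cases hpε : p.1.1 = ε
      · have : U = p.1.2 := by
          ext γ
          constructor
          · exact fun h => ((hpU γ (hU h)).1 h).1
          · exact fun h => (hpU γ (hpε ▸ hP _ p.2.1 _ p.2.2 h)).2 ⟨h, by rw [hpε]⟩
        rw [this, ← hpε]
        exact p.2.2
      · obtain ⟨Δ, hΔ, h⟩ := exists_bound_of_jump_ne hlim (fun ε hε => (hξ ε hε).1)
          (fun ε hε => (hξ ε hε).2) p.2.1 hεS hpε
        refine hPb ε hεS U hU ⟨Δ, hΔ, fun γ hγ => ?_⟩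
        have hγ' := (hpU γ (hU hγ)).1 hγ
        exact h γ (hP _ p.2.1 _ p.2.2 hγ'.1) (hU hγ) hγ'.2
    · obtain ⟨x, hx⟩ := not_isMin_iff.1 (hlim ε hεS).not_isMin
      refine hPb ε hεS U hU ⟨x, hx, fun γ hγ => ?_⟩
      obtain ⟨q, hq, -⟩ := (hbU γ (hU hγ)).1 hγ
      exact absurd ⟨q, hq⟩ hp

/-! ### Separating the members of the chain -/

theorem exists_forall_le_mk_Iio {lam κ : Cardinal.{w}} (hreg : lam.IsRegular) (hκlam : κ < lam) :
    ∃ ε₀ : Idx lam, ∀ ε, ε₀ < ε → κ ≤ #(Set.Iio ε) := by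
  obtain ⟨j⟩ : Nonempty (Idx κ ↪ Idx lam) := by
    rw [← Cardinal.le_def, mk_ord_toType, mk_ord_toType]
    exact hκlam.le
  obtain ⟨ε₀, hε₀⟩ := exists_forall_lt hreg j (by simpa using hκlam)
  refine ⟨ε₀, fun ε hε => ?_⟩
  rw [← Cardinal.mk_ord_toType κ]
  exact Cardinal.mk_le_of_injective (f := fun i => (⟨j i, (hε₀ i).trans hε⟩ : Set.Iio ε))
    fun i i' h => j.injective (congrArg Subtype.val h)

theorem mk_formulas_le :
    #(Σ n m : ℕ, L.Formula (Fin n ⊕ Fin m)) ≤ max ℵ₀ L.card := by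
  have h1 : ∀ n m : ℕ, #(L.Formula (Fin n ⊕ Fin m)) ≤ max ℵ₀ L.card := by
    intro n m
    have h2 : #(L.Formula (Fin n ⊕ Fin m)) ≤ #(Σ k, L.BoundedFormula (Fin n ⊕ Fin m) k) :=
      Cardinal.mk_le_of_injective (f := fun φ => ⟨0, φ⟩) fun φ ψ h => by simpa using h
    refine h2.trans (Language.BoundedFormula.card_le.trans (max_le (le_max_left _ _) ?_))
    refine Cardinal.add_le_of_le (le_max_left _ _) ?_ (by simp)
    exact le_trans (by simp) (le_max_left _ _)
  have h3 : ∀ n : ℕ, #(Σ m : ℕ, L.Formula (Fin n ⊕ Fin m)) ≤ max ℵ₀ L.card := by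
    intro n
    rw [Cardinal.mk_sigma]
    refine (Cardinal.sum_le_sum _ (fun _ => max ℵ₀ L.card) (h1 n)).trans ?_
    rw [Cardinal.sum_const]
    exact Cardinal.mul_le_of_le (le_max_left _ _) (by simp) (by simp)
  rw [Cardinal.mk_sigma]
  refine (Cardinal.sum_le_sum _ (fun _ => max ℵ₀ L.card) h3).trans ?_
  rw [Cardinal.sum_const]
  exact Cardinal.mul_le_of_le (le_max_left _ _) (by simp) (by simp)

theorem lift_mk_formulas_lt {lam : Cardinal.{w}} (hunc : ℵ₀ < lam)
    (hL : Cardinal.lift.{w} L.card < Cardinal.lift.{max u v} lam) :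
    Cardinal.lift.{w} #(Σ n m : ℕ, L.Formula (Fin n ⊕ Fin m)) <
      Cardinal.lift.{max u v} (Order.succ lam) := by
  refine (Cardinal.lift_le.{w}.2 mk_formulas_le).trans_lt ?_
  rw [Cardinal.lift_max, Cardinal.lift_aleph0]
  refine (max_lt ?_ hL).trans (Cardinal.lift_lt.2 (Order.lt_succ lam))
  simpa using hunc

/-- The invariants of the members of a filtration separate, on a club, all indices of
cofinality `κ`. -/
theorem exists_isClub_inv8_ne {T : L.Theory}
    {lam κ : Cardinal.{w}} (hreg : lam.IsRegular) (hunc : ℵ₀ < lam) (hpow : lam ^< lam = lam)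
    (hL : Cardinal.lift.{w} L.card < Cardinal.lift.{max u v} lam)
    (hκ : κ.IsRegular) (hκlam : κ < lam)
    (M : T.ModelType.{u, v, w}) (hsat : IsSaturated L M) (hM : #M = Order.succ lam)
    (C : Idx (Order.succ lam) → L.ElementarySubstructure M) (hC : IsFiltration lam C) :
    ∃ E : Set (Idx (Order.succ lam)), IsClub E ∧
      ∀ δ₁ ∈ E, ∀ δ₂ ∈ E, cofAt δ₁ = κ → cofAt δ₂ = κ → δ₁ ≠ δ₂ →
        ∀ (n m : ℕ) (φ : L.Formula (Fin n ⊕ Fin m)), FormulaHasSIP.{u, v, w} T φ →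
          ∀ (f₁ : C δ₁ ≃ Idx lam) (f₂ : C δ₂ ≃ Idx lam), inv8 φ κ f₁ ≠ inv8 φ κ f₂ := by
  classical
  have hreg' : (Order.succ lam).IsRegular := Cardinal.isRegular_succ hreg.aleph0_le
  obtain ⟨ε₀, hε₀⟩ := exists_forall_le_mk_Iio hreg hκlam
  let S : Set (Idx lam) := {ε | cofAt ε = ℵ₀ ∧ κ ≤ #(Set.Iio ε)}
  have hf : ∀ δ, Nonempty (C δ ≃ Idx lam) := fun δ => Cardinal.eq.1 (by
    rw [mk_ord_toType]; exact hC.card_eq δ)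
  let f₀ := fun δ => (hf δ).some
  let J := Σ n m : ℕ, L.Formula (Fin n ⊕ Fin m)
  -- The family `P δ j ε` is not in the invariant of `C δ` at `ε`.
  have hP : ∀ (δ : Idx (Order.succ lam)) (j : J) (ε : Idx lam), ∃ P : Set (Set (Idx lam)),
      ε ∈ S → (∀ U ∈ P, U ⊆ Set.Iio ε) ∧
        (∀ U ⊆ Set.Iio ε, (∃ Δ < ε, ∀ γ ∈ U, γ < Δ) → U ∈ P) ∧
          P ∉ inv7 j.2.2 κ (f₀ δ) ε := by
    intro δ j ε
    by_cases hε : ε ∈ S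
    · obtain ⟨P, hP⟩ := exists_notMem_inv7 j.2.2 hκ.aleph0_le (f₀ δ) hε.2
      exact ⟨P, fun _ => hP⟩
    · exact ⟨∅, fun h => absurd h hε⟩
  choose P hP using hP
  have hg : ∀ (δ : Idx (Order.succ lam)) (j : J), ∃ g : Idx (Order.succ lam) → Idx (Order.succ lam),
      FormulaHasSIP.{u, v, w} T j.2.2 → ∀ δ', cofAt δ' = κ → (∀ α < δ', g α < δ') →
        ∀ f : C δ' ≃ Idx lam, ∃ K : Set (Idx lam), IsClub K ∧
          ∀ ε ∈ K, ε ∈ S → P δ j ε ∈ inv7 j.2.2 κ f ε := by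
    intro δ j
    by_cases hj : FormulaHasSIP.{u, v, w} T j.2.2
    · obtain ⟨g, hg⟩ := exists_forall_mem_inv7 hsat hreg hunc hpow hκ hκlam hM hC hj.1 j.2.2
        (hj.2 M) S (fun ε hε => hε.1) (P δ j) (fun ε hε => (hP δ j ε hε).1)
        (fun ε hε => (hP δ j ε hε).2.1)
      exact ⟨g, fun _ => hg⟩
    · exact ⟨id, fun h => absurd h hj⟩
  choose g hg using hg
  refine ⟨_, isClub_closurePoints hreg' (hunc.trans (Order.lt_succ lam)) (J := J)
    (lift_mk_formulas_lt hunc hL) (fun δ α j => g δ j α), ?_⟩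
  have main : ∀ δ₁ δ₂ : Idx (Order.succ lam),
      (∀ γ < δ₂, ∀ ξ < δ₂, ∀ j, g γ j ξ < δ₂) → cofAt δ₂ = κ → δ₁ < δ₂ →
        ∀ (n m : ℕ) (φ : L.Formula (Fin n ⊕ Fin m)), FormulaHasSIP.{u, v, w} T φ →
          ∀ (f₁ : C δ₁ ≃ Idx lam) (f₂ : C δ₂ ≃ Idx lam), inv8 φ κ f₁ ≠ inv8 φ κ f₂ := by
    intro δ₁ δ₂ hδ₂ hcof hlt n m φ hφ f₁ f₂ heq
    let j : J := ⟨n, m, φ⟩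
    obtain ⟨K₀, hK₀, hK₀c⟩ := exists_isClub_subset hreg hunc (Filter.Germ.coe_eq.1 heq)
    obtain ⟨K₁, hK₁c, hK₁⟩ := exists_isClub_inv7_eq (L := L) κ hreg hunc f₁ (f₀ δ₁)
    obtain ⟨K₂, hK₂c, hK₂⟩ := hg δ₁ j hφ δ₂ hcof (fun α hα => hδ₂ δ₁ hlt α hα j) f₂
    have hne : Order.cof (Idx lam) ≠ ℵ₀ := by rw [cof_idx hreg]; exact hunc.ne'
    obtain ⟨ε, ⟨⟨hε0, hε1⟩, hε2⟩, hεε, hεcof⟩ := exists_mem_isClub_cofAt_eq hreg isRegular_aleph0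
      hunc ((hK₀c.inter hne hK₁c).inter hne hK₂c) ε₀
    have hεS : ε ∈ S := ⟨hεcof, hε₀ ε hεε⟩
    refine (hP δ₁ j ε hεS).2.2 ?_
    have h0 : inv7 φ κ f₁ ε = inv7 φ κ f₂ ε := hK₀ hε0
    rw [← hK₁ ε hε1, h0]
    exact hK₂ ε hε2 hεS
  intro δ₁ h₁ δ₂ h₂ hc₁ hc₂ hne n m φ hφ f₁ f₂
  rcases lt_or_gt_of_ne hne with h | h
  · exact main δ₁ δ₂ h₂ hc₂ h n m φ hφ f₁ f₂
  · exact (main δ₂ δ₁ h₁ hc₁ h n m φ hφ f₂ f₁).symm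

theorem isEmpty_equiv_of_inv8_ne {N N' : Type w} [L.Structure N] [L.Structure N'] {n m : ℕ}
    (φ : L.Formula (Fin n ⊕ Fin m)) (κ : Cardinal.{w}) {lam : Cardinal.{w}} (f' : N' ≃ Idx lam)
    (h : ∀ (f : N ≃ Idx lam), inv8 φ κ f ≠ inv8 φ κ f') : IsEmpty (N ≃[L] N') := by
  refine ⟨fun e => h (e.toEquiv.trans f') ?_⟩
  simp only [inv8, ← inv7_equiv e φ κ f']

theorem exists_isClub_isEmpty_equiv {T : L.Theory} (hSIP : HasSIP.{u, v, w} T)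
    {lam κ : Cardinal.{w}} (hreg : lam.IsRegular) (hunc : ℵ₀ < lam) (hpow : lam ^< lam = lam)
    (hL : Cardinal.lift.{w} L.card < Cardinal.lift.{max u v} lam)
    (hκ : κ.IsRegular) (hκlam : κ < lam)
    (M : T.ModelType.{u, v, w}) (hsat : IsSaturated L M) (hM : #M = Order.succ lam)
    (C : Idx (Order.succ lam) → L.ElementarySubstructure M) (hC : IsFiltration lam C) :
    ∃ E : Set (Idx (Order.succ lam)), IsClub E ∧
      ∀ δ₁ ∈ E, ∀ δ₂ ∈ E, cofAt δ₁ = κ → cofAt δ₂ = κ → δ₁ ≠ δ₂ →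
        IsEmpty (C δ₁ ≃[L] C δ₂) ∧
        ∀ (n m : ℕ) (φ : L.Formula (Fin n ⊕ Fin m)), FormulaHasSIP.{u, v, w} T φ →
          ∀ (f₁ : C δ₁ ≃ Idx lam) (f₂ : C δ₂ ≃ Idx lam), inv8 φ κ f₁ ≠ inv8 φ κ f₂ := by
  obtain ⟨E, hE, h⟩ := exists_isClub_inv8_ne hreg hunc hpow hL hκ hκlam M hsat hM C hC
  refine ⟨E, hE, fun δ₁ h₁ δ₂ h₂ hc₁ hc₂ hne => ⟨?_, h δ₁ h₁ δ₂ h₂ hc₁ hc₂ hne⟩⟩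
  obtain ⟨n, m, φ, hφ⟩ := hSIP
  obtain ⟨f₂⟩ : Nonempty (C δ₂ ≃ Idx lam) := Cardinal.eq.1 (by
    rw [mk_ord_toType]; exact hC.card_eq δ₂)
  exact isEmpty_equiv_of_inv8_ne φ κ f₂ fun f₁ => h δ₁ h₁ δ₂ h₂ hc₁ hc₂ hne n m φ hφ f₁ f₂

theorem limitNumber_ne_one {lam κ : Cardinal.{w}} (hreg : lam.IsRegular)
    (hκ : κ.IsRegular) (hκlam : κ < lam) {M : Type w} [L.Structure M]
    {C : Idx (Order.succ lam) → L.ElementarySubstructure M}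
    {E : Set (Idx (Order.succ lam))} (hE : IsClub E)
    (h : ∀ δ₁ ∈ E, ∀ δ₂ ∈ E, cofAt δ₁ = κ → cofAt δ₂ = κ → δ₁ ≠ δ₂ →
      IsEmpty (C δ₁ ≃[L] C δ₂)) : limitNumber C κ ≠ 1 := by
  intro h1
  have hreg' : (Order.succ lam).IsRegular := Cardinal.isRegular_succ hreg.aleph0_le
  -- The infimum defining `limitNumber` is attained, at some club `E'`.
  have hmem := csInf_mem (s := {c | ∃ E : Set (Idx (Order.succ lam)), IsClub E ∧
    c = #((fun δ => isoType L (C δ)) '' {δ | δ ∈ E ∧ cofAt δ = κ})}) ⟨_, _, IsClub.univ, rfl⟩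
  obtain ⟨E', hE', hcard⟩ := hmem
  have hcard : #((fun δ => isoType L (C δ)) '' {δ | δ ∈ E' ∧ cofAt δ = κ}) = 1 :=
    hcard.symm.trans h1
  have hne : Order.cof (Idx (Order.succ lam)) ≠ ℵ₀ := by
    rw [cof_idx hreg']
    exact (hreg.aleph0_le.trans_lt (Order.lt_succ lam)).ne'
  obtain ⟨a⟩ : Nonempty (Idx (Order.succ lam)) := by
    rw [← Cardinal.mk_ne_zero_iff]
    simp
  have hκ' : κ < Order.succ lam := hκlam.trans (Order.lt_succ lam)
  obtain ⟨δ₁, ⟨h₁, h₁'⟩, -, hc₁⟩ := exists_mem_isClub_cofAt_eq hreg' hκ hκ' (hE.inter hne hE') a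
  obtain ⟨δ₂, ⟨h₂, h₂'⟩, hlt, hc₂⟩ := exists_mem_isClub_cofAt_eq hreg' hκ hκ' (hE.inter hne hE') δ₁
  have hsub := (Cardinal.le_one_iff_subsingleton.1 hcard.le).elim
    ⟨_, δ₁, ⟨h₁', hc₁⟩, rfl⟩ ⟨_, δ₂, ⟨h₂', hc₂⟩, rfl⟩
  have hiso : isoType L (C δ₁) = isoType L (C δ₂) := congrArg Subtype.val hsub
  obtain ⟨e⟩ := Quotient.exact hiso
  exact (h δ₁ h₁ δ₂ h₂ hc₁ hc₂ hlt.ne).false e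

end NoLimitModel

open NoLimitModel in
theorem theorem1p9 {L : FirstOrder.Language.{u, v}} (T : L.Theory) (hT : T.IsComplete)
    (hSIP : HasSIP.{u, v, w} T)
    (lam κ : Cardinal.{w}) (hreg : lam.IsRegular) (hunc : ℵ₀ < lam) (hpow : lam ^< lam = lam)
    (hL : Cardinal.lift.{w} L.card < Cardinal.lift.{max u v} lam)
    (hκ : κ.IsRegular) (hκlam : κ < lam) (hGCH : (2 : Cardinal.{w}) ^ lam = Order.succ lam)
    (M : T.ModelType.{u, v, w}) (hsat : IsSaturated L M) (hM : #M = Order.succ lam)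
    (C : Idx (Order.succ lam) → L.ElementarySubstructure M) (hC : IsFiltration lam C) :
    (∃ E : Set (Idx (Order.succ lam)), IsClub E ∧
      ∀ δ₁ ∈ E, ∀ δ₂ ∈ E, cofAt δ₁ = κ → cofAt δ₂ = κ → δ₁ ≠ δ₂ →
        IsEmpty (C δ₁ ≃[L] C δ₂) ∧
        ∀ (n m : ℕ) (φ : L.Formula (Fin n ⊕ Fin m)), FormulaHasSIP.{u, v, w} T φ →
          ∀ (f₁ : C δ₁ ≃ Idx lam) (f₂ : C δ₂ ≃ Idx lam), inv8 φ κ f₁ ≠ inv8 φ κ f₂) ∧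
    ¬ HasLimitModel T lam κ := by
  refine ⟨exists_isClub_isEmpty_equiv hSIP hreg hunc hpow hL hκ hκlam M hsat hM C hC, ?_⟩
  rintro ⟨M', C', hsat', hM', hC', h1⟩
  obtain ⟨E, hE, h⟩ :=
    exists_isClub_isEmpty_equiv hSIP hreg hunc hpow hL hκ hκlam M' hsat' hM' C' hC'
  exact limitNumber_ne_one hreg hκ hκlam hE
    (fun δ₁ h₁ δ₂ h₂ hc₁ hc₂ hne => (h δ₁ h₁ δ₂ h₂ hc₁ hc₂ hne).1) h1
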